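/- Let $P_0$ be a probability measure on $\mathbb{R}^d$ whose support is bounded with $\operatorname{diam}(\operatorname{supp}P_0)\le R<\infty$. Let $(X_t)_{t\ge 0}$ be the forward process $dX_t=-\tfrac12X_t\,dt+\sqrt{C}\,dB_t$ with $C=I_d$ and $X_0\sim P_0$, where $B$ is a standard $d$-dimensional Brownian motion independent of $X_0$. Then for every $t>0$ the law of $X_t$ has a smooth, everywhere positive density $p_t$ with respect to Lebesgue measure. Let $\delta>0$, $A=(1-e^{-\delta})I_d$ and, for $t\ge\delta$, $\bar A_t=Ae^{-(t-\delta)}+C(1-e^{-(t-\delta)})$ (the initial time being $\delta$). Then for all $t\ge\delta$ we have $\bar A_t=(1-e^{-t})I_d$ and $$\sup_{x\in\mathbb{R}^d}\big\|\nabla^2\log p_t(x)+\bar A_t^{-1}\big\|\le 3\Big(\frac{R}{1-e^{-\delta}}\Big)^2e^{-t},$$ where $\|\cdot\|$ is the operator norm. If moreover $\operatorname{supp}P_0$ is contained in the closed ball of radius $R$ around the origin, then also, for all $t\ge\delta$, with the Euclidean norm $|\cdot|$, $$\sup_{x\in\mathbb{R}^d}\big|\nabla\log p_t(x)+\bar A_t^{-1}x\big|\le\frac{R}{1-e^{-\delta}}\,e^{-t/2}.$$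 -/

import Mathlib

open MeasureTheory ProbabilityTheory
open scoped NNReal ENNReal Gradient MatrixOrder

noncomputable section

/-- The space `ℝ^d` with its Euclidean norm. -/
abbrev Rd (d : ℕ) : Type := EuclideanSpace ℝ (Fin d)

/-- A `d`-dimensional standard Brownian motion: the coordinates are mutually independent
one-dimensional standard Brownian motions (started at `0`, with almost surely continuous paths). -/
structure IsBrownianMotion {d : ℕ} {Ω : Type*} [MeasurableSpace Ω]
    (B : ℝ≥0 → Ω → Rd d) (μ : Measure Ω) : Prop where
  coord : ∀ i : Fin d, IsBrownianReal (fun t ω => B t ω i) μ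
  indep : iIndepFun (fun (i : Fin d) (w : Ω) (t : ℝ≥0) => B t w i) μ

/-- `X` solves `dX_t = -(1/2) X_t dt + √C dB_t`, where `B` is a standard Brownian motion
independent of `X_0` and `X_0` has law `P₀`. As the noise is additive, the equation is the pathwise
identity `X_t = X_0 - (1/2) ∫_0^t X_s ds + √C B_t` for all `t ≥ 0`, almost surely. -/
structure IsForwardProcess {d : ℕ} {Ω : Type*} [MeasurableSpace Ω]
    (C : Matrix (Fin d) (Fin d) ℝ) (P₀ : Measure (Rd d))
    (B X : ℝ≥0 → Ω → Rd d) (μ : Measure Ω) : Prop where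
  brownian : IsBrownianMotion B μ
  initial : HasLaw (X 0) P₀ μ
  indep : IndepFun (X 0) (fun (ω : Ω) (t : ℝ≥0) => B t ω) μ
  aemeasurable : ∀ t, AEMeasurable (X t) μ
  continuous_paths : ∀ᵐ ω ∂μ, Continuous (fun t => X t ω)
  equation : ∀ᵐ ω ∂μ, ∀ t : ℝ≥0,
    X t ω = X 0 ω - (1 / 2 : ℝ) • (∫ s in (0 : ℝ)..(t : ℝ), X s.toNNReal ω)
      + Matrix.toEuclideanCLM (𝕜 := ℝ) (CFC.sqrt C) (B t ω)

/-- The support of `P` is bounded, of diameter at most `R`. -/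
def BoundedSupport {d : ℕ} (P : Measure (Rd d)) (R : ℝ) : Prop :=
  Bornology.IsBounded P.support ∧ Metric.diam P.support ≤ R

/-- `p` is an everywhere positive and smooth probability density of `P` with respect to Lebesgue
measure. (There is at most one, because a continuous density is unique.) -/
structure IsSmoothDensity {d : ℕ} (p : Rd d → ℝ) (P : Measure (Rd d)) : Prop where
  smooth : ContDiff ℝ (⊤ : ℕ∞) p
  pos : ∀ x, 0 < p x
  density : P = volume.withDensity (fun x => ENNReal.ofReal (p x))

/-- The matrix `A e^{-s} + C (1 - e^{-s})`, where `s` is the time elapsed since the time at which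
the reference covariance is `A`. -/
def interpCov {d : ℕ} (A C : Matrix (Fin d) (Fin d) ℝ) (s : ℝ) : Matrix (Fin d) (Fin d) ℝ :=
  Real.exp (-s) • A + (1 - Real.exp (-s)) • C

/-- The Hessian of `f` at `x`, the derivative of the gradient, as a linear operator on `ℝ^d`. -/
def hessian {d : ℕ} (f : Rd d → ℝ) (x : Rd d) : Rd d →L[ℝ] Rd d :=
  fderiv ℝ (gradient f) x

/-- The supremum over `x ∈ ℝ^d` of the norm of `f x`, with values in `[0, ∞]`: the Euclidean norm for
vector fields, the operator norm for operator fields. -/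
def supNorm {d : ℕ} {F : Type*} [NormedAddCommGroup F] (f : Rd d → F) : ℝ≥0∞ :=
  ⨆ x, ‖f x‖ₑ

end

noncomputable section

/-! ### Exponential moments of boundedly supported measures and their tilted means. -/

section LaplaceMoment

variable {E G : Type*} [NormedAddCommGroup E] [InnerProductSpace ℝ E] [NormedAddCommGroup G]

/-! The forward process is an Ornstein–Uhlenbeck process, so `X t` has the law of `m • X₀ + √v • Z`
with `m = exp (-t / 2)`, `v = 1 - exp (-t)` and `Z` an independent standard Gaussian
(`IsForwardProcess.map_eq_withDensity`). Hence its density is the Gaussian mixture `smoothedDensity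
P₀ m v`.

Expanding the square in the Gaussian kernel writes this mixture as the centred Gaussian density
times the Laplace transform of a finite measure `Q` carried by the support of `P₀` scaled by `m / v`
(`smoothedDensity_eq`). Taking logarithms, the Gaussian contributes exactly `-v⁻¹ • x` to the score,
and what remains is the mean of the probability measure proportional to `exp ⟪x, y⟫ Q(dy)`. Its norm
is at most `m / v * R` if the support lies in the ball of radius `R`. Its derivative is the
covariance of the tilted measure, which is invariant under translation and hence controlled by the
diameter alone: at most `2 * (m / v * R) ^ 2`. The theorem follows from `v ≥ 1 - exp (-δ)` and `m ^
2 = exp (-t)`.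

The law of `X t` is found without stochastic integration: Riemann sums of the Wiener integral
converge path by path (`tendsto_ouSum`), their characteristic functions are explicit, and the limit
is identified by dominated convergence. -/

theorem continuous_innerSL_smulRight [NormedSpace ℝ G] {g : E → G} (hg : Continuous g) :
    Continuous fun y => (innerSL ℝ y).smulRight (g y) :=
  ((ContinuousLinearMap.smulRightL ℝ E G).continuous.comp (innerSL ℝ).continuous).clm_apply hg

variable [FiniteDimensional ℝ E] [MeasurableSpace E] [BorelSpace E]

/-- A continuous function is integrable for a finite measure with bounded support. -/
theorem integrable_of_continuous_of_ae_norm_le {Q : Measure E} [IsFiniteMeasure Q] {r : ℝ}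
    (hQ : ∀ᵐ y ∂Q, ‖y‖ ≤ r) {f : E → G} (hf : Continuous f) : Integrable f Q := by
  obtain ⟨C, hC⟩ := (isCompact_closedBall (0 : E) r).exists_bound_of_continuousOn hf.continuousOn
  refine Integrable.of_bound hf.aestronglyMeasurable C ?_
  filter_upwards [hQ] with y hy
  exact hC y (by simpa using hy)

variable [NormedSpace ℝ G]

theorem integrable_exp_inner_smul {Q : Measure E} [IsFiniteMeasure Q] {r : ℝ}
    (hQ : ∀ᵐ y ∂Q, ‖y‖ ≤ r) {g : E → G} (hg : Continuous g) (x : E) :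
    Integrable (fun y => Real.exp (inner ℝ x y) • g y) Q :=
  integrable_of_continuous_of_ae_norm_le hQ (by fun_prop)

/-- The moment of `g` for the measure `exp ⟪x, y⟫ Q(dy)`. -/
def laplaceMoment (Q : Measure E) (g : E → G) (x : E) : G :=
  ∫ y, Real.exp (inner ℝ x y) • g y ∂Q

/-- Differentiation under the integral. The derivative is again a moment, with a new continuous
weight, so the family is closed under differentiation; this is why `g` may take values in any normed
space. -/
theorem hasFDerivAt_laplaceMoment {Q : Measure E} [IsFiniteMeasure Q] {r : ℝ}
    (hQ : ∀ᵐ y ∂Q, ‖y‖ ≤ r) {g : E → G} (hg : Continuous g) (x : E) :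
    HasFDerivAt (laplaceMoment Q g)
      (laplaceMoment Q (fun y => (innerSL ℝ y).smulRight (g y)) x) x := by
  have hg' := continuous_innerSL_smulRight hg
  obtain ⟨C, hC⟩ := (isCompact_closedBall (0 : E) r).exists_bound_of_continuousOn
    hg'.continuousOn
  refine hasFDerivAt_integral_of_dominated_of_fderiv_le (s := Metric.ball x 1)
    (F' := fun x y => Real.exp (inner ℝ x y) • (innerSL ℝ y).smulRight (g y))
    (bound := fun _ => Real.exp ((‖x‖ + 1) * r) * C)
    (Metric.ball_mem_nhds x one_pos) ?_ ?_ ?_ ?_ ?_ ?_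
  · exact Filter.Eventually.of_forall fun z =>
      Continuous.aestronglyMeasurable (by fun_prop)
  · exact integrable_of_continuous_of_ae_norm_le hQ (by fun_prop)
  · exact Continuous.aestronglyMeasurable (by fun_prop)
  · filter_upwards [hQ] with y hy z hz
    have hz' : ‖z‖ ≤ ‖x‖ + 1 := by
      have h1 : ‖z - x‖ < 1 := by simpa [dist_eq_norm] using hz
      have h2 := norm_add_le (z - x) x
      rw [sub_add_cancel] at h2
      linarith
    rw [norm_smul, Real.norm_eq_abs, Real.abs_exp]
    gcongr
    · exact (real_inner_le_norm z y).trans (by gcongr)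
    · exact hC y (by simpa using hy)
  · exact integrable_const _
  · refine Filter.Eventually.of_forall fun y z _ => ?_
    have h : HasFDerivAt (fun z : E => inner ℝ z y) (innerSL ℝ y) z := by
      have := (innerSL ℝ y).hasFDerivAt (x := z)
      refine this.congr_of_eventuallyEq (Filter.Eventually.of_forall fun w => ?_)
      simp [real_inner_comm]
    convert! h.exp.smul_const (g y) using 1
    ext w
    simp [smul_smul]

theorem contDiff_laplaceMoment {Q : Measure E} [IsFiniteMeasure Q] {r : ℝ}
    (hQ : ∀ᵐ y ∂Q, ‖y‖ ≤ r) [CompleteSpace G] {g : E → G} (hg : Continuous g) :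
    ContDiff ℝ (⊤ : ℕ∞) (laplaceMoment Q g) := by
  rw [contDiff_infty]
  intro n
  induction n generalizing g with
  | zero =>
    exact contDiff_zero.2 (continuous_iff_continuousAt.2 fun x =>
      (hasFDerivAt_laplaceMoment hQ hg x).continuousAt)
  | succ n ih =>
    push_cast
    -- Derivatives in a fixed direction `u` are moments of a weight with values in the same space
    -- `G`, so the induction hypothesis applies.
    refine contDiff_succ_iff_fderiv_apply.2 ⟨fun x =>
      (hasFDerivAt_laplaceMoment hQ hg x).differentiableAt, by simp, fun u => ?_⟩
    have h : (fun x => fderiv ℝ (laplaceMoment Q g) x u)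
        = laplaceMoment Q (fun y => inner ℝ y u • g y) := by
      funext x
      rw [(hasFDerivAt_laplaceMoment hQ hg x).fderiv]
      unfold laplaceMoment
      rw [ContinuousLinearMap.integral_apply
        (integrable_exp_inner_smul hQ (continuous_innerSL_smulRight hg) x)]
      simp
    rw [h]
    exact ih (by fun_prop)

theorem laplaceMoment_one_pos {Q : Measure E} [IsFiniteMeasure Q] [NeZero Q] {r : ℝ}
    (hQ : ∀ᵐ y ∂Q, ‖y‖ ≤ r) (x : E) : 0 < laplaceMoment Q (fun _ => (1 : ℝ)) x := by
  have h : laplaceMoment Q (fun _ => (1 : ℝ)) x = ∫ y, Real.exp (inner ℝ x y) ∂Q := by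
    simp [laplaceMoment]
  rw [h]
  exact integral_exp_pos (integrable_of_continuous_of_ae_norm_le hQ (by fun_prop))

theorem norm_laplaceMoment_le {Q : Measure E} [IsFiniteMeasure Q] {r : ℝ}
    (hQ : ∀ᵐ y ∂Q, ‖y‖ ≤ r) {g : E → G} {c : ℝ} (hg : ∀ y, ‖y‖ ≤ r → ‖g y‖ ≤ c) (x : E) :
    ‖laplaceMoment Q g x‖ ≤ c * laplaceMoment Q (fun _ => (1 : ℝ)) x := by
  have h : c * laplaceMoment Q (fun _ => (1 : ℝ)) x = ∫ y, Real.exp (inner ℝ x y) * c ∂Q := by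
    simp only [laplaceMoment, smul_eq_mul, mul_one]
    rw [integral_mul_const, mul_comm]
  rw [h]
  refine norm_integral_le_of_norm_le (integrable_of_continuous_of_ae_norm_le hQ (by fun_prop)) ?_
  filter_upwards [hQ] with y hy
  rw [norm_smul, Real.norm_eq_abs, Real.abs_exp]
  gcongr
  exact hg y hy

/-- The mean of the probability measure proportional to `exp ⟪x, y⟫ Q(dy)`. -/
def tiltedMean (Q : Measure E) (x : E) : E :=
  (laplaceMoment Q (fun _ => (1 : ℝ)) x)⁻¹ • laplaceMoment Q (fun y => y) x

theorem norm_tiltedMean_le {Q : Measure E} [IsFiniteMeasure Q] [NeZero Q] {r : ℝ}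
    (hQ : ∀ᵐ y ∂Q, ‖y‖ ≤ r) (x : E) : ‖tiltedMean Q x‖ ≤ r := by
  have hM := laplaceMoment_one_pos hQ x
  rw [tiltedMean, norm_smul, Real.norm_eq_abs, abs_of_pos (inv_pos.2 hM), inv_mul_le_iff₀ hM,
    mul_comm]
  exact norm_laplaceMoment_le hQ (fun _ h => h) x

theorem hasGradientAt_log_laplaceMoment {Q : Measure E} [IsFiniteMeasure Q] [NeZero Q] {r : ℝ}
    (hQ : ∀ᵐ y ∂Q, ‖y‖ ≤ r) (x : E) :
    HasGradientAt (fun z => Real.log (laplaceMoment Q (fun _ => (1 : ℝ)) z))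
      (tiltedMean Q x) x := by
  have hM := laplaceMoment_one_pos hQ x
  rw [hasGradientAt_iff_hasFDerivAt]
  convert! (hasFDerivAt_laplaceMoment hQ (continuous_const (y := (1 : ℝ))) x).log hM.ne' using 1
  ext u
  simp only [tiltedMean, map_smul, smul_apply]
  congr 1
  unfold laplaceMoment
  rw [ContinuousLinearMap.integral_apply
    (integrable_exp_inner_smul hQ (continuous_innerSL_smulRight continuous_const) x),
    InnerProductSpace.toDual_apply_apply, real_inner_comm,
    ← integral_inner (integrable_of_continuous_of_ae_norm_le hQ (by fun_prop))]
  refine integral_congr_ae (Filter.Eventually.of_forall fun y => ?_)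
  simp [inner_smul_right, real_inner_comm]

/-- By the quotient rule, the derivative is the second moment minus the product of the means, i.e.
the covariance. Bounding each of the two terms by `r ^ 2` is crude but sufficient. -/
theorem tiltedMean_hasFDerivAt_norm_le {Q : Measure E} [IsFiniteMeasure Q] [NeZero Q] {r : ℝ}
    (hQ : ∀ᵐ y ∂Q, ‖y‖ ≤ r) (x : E) :
    ∃ V : E →L[ℝ] E, HasFDerivAt (tiltedMean Q) V x ∧ ‖V‖ ≤ 2 * r ^ 2 := by
  have hM := laplaceMoment_one_pos hQ x
  have hr : 0 ≤ r := (norm_nonneg _).trans (norm_tiltedMean_le hQ x)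
  have h1 := hasFDerivAt_laplaceMoment hQ (continuous_const (y := (1 : ℝ))) x
  have h2 := hasFDerivAt_laplaceMoment hQ (continuous_id' (X := E)) x
  have b1 := norm_laplaceMoment_le hQ (g := fun y : E => (innerSL ℝ y).smulRight (1 : ℝ)) (c := r)
    (fun y hy => by simpa [ContinuousLinearMap.norm_smulRight_apply] using hy) x
  have b2 := norm_laplaceMoment_le hQ (g := fun y : E => (innerSL ℝ y).smulRight y) (c := r ^ 2)
    (fun y hy => by
      rw [ContinuousLinearMap.norm_smulRight_apply, innerSL_apply_norm, ← sq]
      gcongr) x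
  have b3 := norm_laplaceMoment_le hQ (g := fun y : E => y) (c := r) (fun _ h => h) x
  have h3 := ((hasDerivAt_inv hM.ne').comp_hasFDerivAt x h1).smul h2
  refine ⟨_, h3, ?_⟩
  set M := laplaceMoment Q (fun _ => (1 : ℝ)) x
  refine (norm_add_le _ _).trans ?_
  have e1 : ‖M⁻¹ • laplaceMoment Q (fun y : E => (innerSL ℝ y).smulRight y) x‖ ≤ r ^ 2 := by
    rw [norm_smul, Real.norm_eq_abs, abs_of_pos (inv_pos.2 hM), inv_mul_le_iff₀ hM, mul_comm]
    exact b2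
  have e2 : ‖((-(M ^ 2)⁻¹) • laplaceMoment Q
      (fun y : E => (innerSL ℝ y).smulRight (1 : ℝ)) x).smulRight
        (laplaceMoment Q (fun y : E => y) x)‖ ≤ r ^ 2 := by
    rw [ContinuousLinearMap.norm_smulRight_apply, norm_smul, norm_neg, Real.norm_eq_abs,
      abs_of_pos (by positivity), mul_assoc, inv_mul_le_iff₀ (by positivity)]
    calc _ ≤ (r * M) * (r * M) := by gcongr
      _ = M ^ 2 * r ^ 2 := by ring
  have := add_le_add e1 e2
  refine this.trans (by linarith)

/-- Translating the measure multiplies every exponential weight by the same factor `exp (-⟪x, c⟫)`,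
which the normalization cancels. -/
theorem tiltedMean_map_sub {Q : Measure E} [IsFiniteMeasure Q] [NeZero Q] {r : ℝ}
    (hQ : ∀ᵐ y ∂Q, ‖y‖ ≤ r) (c x : E) :
    tiltedMean Q x = tiltedMean (Q.map (fun y => y - c)) x + c := by
  have hM := laplaceMoment_one_pos hQ x
  have h1 : laplaceMoment (Q.map (fun y => y - c)) (fun _ => (1 : ℝ)) x
      = Real.exp (-inner ℝ x c) * laplaceMoment Q (fun _ => (1 : ℝ)) x := by
    unfold laplaceMoment
    rw [integral_map (by fun_prop) (Continuous.aestronglyMeasurable (by fun_prop)),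
      ← integral_const_mul]
    refine integral_congr_ae (Filter.Eventually.of_forall fun y => ?_)
    simp only [inner_sub_right, smul_eq_mul, mul_one, ← Real.exp_add, neg_add_eq_sub]
  have h2 : laplaceMoment (Q.map (fun y => y - c)) (fun y => y) x
      = Real.exp (-inner ℝ x c) • (laplaceMoment Q (fun y => y) x
        - laplaceMoment Q (fun _ => (1 : ℝ)) x • c) := by
    unfold laplaceMoment
    rw [integral_map (by fun_prop) (Continuous.aestronglyMeasurable (by fun_prop)),
      ← integral_smul_const, ← integral_sub, ← integral_smul]
    · refine integral_congr_ae (Filter.Eventually.of_forall fun y => ?_)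
      simp only [inner_sub_right, sub_eq_neg_add (inner ℝ x y), Real.exp_add, smul_eq_mul, mul_one,
        smul_sub, smul_smul]
    · exact integrable_of_continuous_of_ae_norm_le hQ (by fun_prop)
    · exact integrable_of_continuous_of_ae_norm_le hQ (by fun_prop)
  unfold tiltedMean
  rw [h1, h2, mul_inv, smul_smul, mul_right_comm, inv_mul_cancel₀ (Real.exp_ne_zero _), one_mul,
    smul_sub, smul_smul, inv_mul_cancel₀ hM.ne', one_smul, sub_add_cancel]

/-- The covariance of the tilted measures is bounded in terms of the distance to any center. -/
theorem norm_fderiv_tiltedMean_le {Q : Measure E} [IsFiniteMeasure Q] [NeZero Q] {r s : ℝ}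
    (hQ : ∀ᵐ y ∂Q, ‖y‖ ≤ r) {c : E} (hs : ∀ᵐ y ∂Q, ‖y - c‖ ≤ s) (x : E) :
    ∃ V : E →L[ℝ] E, HasFDerivAt (tiltedMean Q) V x ∧ ‖V‖ ≤ 2 * s ^ 2 := by
  have hm : AEMeasurable (fun y : E => y - c) Q := by fun_prop
  have : NeZero (Q.map (fun y => y - c)) :=
    ⟨by rw [Ne, Measure.map_eq_zero_iff hm]; exact NeZero.ne Q⟩
  have h : ∀ᵐ y ∂(Q.map (fun y => y - c)), ‖y‖ ≤ s :=
    (ae_map_iff hm (measurableSet_le (by fun_prop) (by fun_prop))).2 hs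
  obtain ⟨V, hV, hb⟩ := tiltedMean_hasFDerivAt_norm_le h x
  refine ⟨V, ?_, hb⟩
  rw [funext (tiltedMean_map_sub hQ c)]
  exact hV.add_const c

end LaplaceMoment

/-! ### Gaussian mixtures, their Laplace representation and their score. -/

section GaussianSmoothing

variable {E : Type*} [NormedAddCommGroup E] [InnerProductSpace ℝ E]

/-- The density of the centered Gaussian measure with covariance `v • 1`. -/
def gaussianDensity (v : ℝ) (z : E) : ℝ :=
  ((2 * Real.pi * v) ^ (Module.finrank ℝ E / 2 : ℝ))⁻¹ * Real.exp (-(2 * v)⁻¹ * ‖z‖ ^ 2)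

@[fun_prop]
theorem continuous_gaussianDensity (v : ℝ) : Continuous (gaussianDensity (E := E) v) := by
  unfold gaussianDensity
  fun_prop

theorem gaussianDensity_pos {v : ℝ} (hv : 0 < v) (z : E) : 0 < gaussianDensity v z := by
  unfold gaussianDensity
  positivity

theorem gaussianDensity_le {v : ℝ} (hv : 0 < v) (z : E) :
    gaussianDensity v z ≤ ((2 * Real.pi * v) ^ (Module.finrank ℝ E / 2 : ℝ))⁻¹ := by
  unfold gaussianDensity
  refine mul_le_of_le_one_right (by positivity) (Real.exp_le_one_iff.2 ?_)
  rw [neg_mul]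
  exact neg_nonpos.2 (by positivity)

variable [MeasurableSpace E]

/-- The density of the law of `m • Y + √v • Z` with `Y` of law `P` and `Z` standard Gaussian
independent of `Y`. -/
def smoothedDensity (P : Measure E) (m v : ℝ) (x : E) : ℝ :=
  ∫ y, gaussianDensity v (x - m • y) ∂P

/-- Up to a Gaussian factor, `smoothedDensity P m v` is the Laplace transform of this measure. -/
def weightedMeasure (P : Measure E) (m v : ℝ) : Measure E :=
  (P.withDensity fun y => ENNReal.ofReal (Real.exp (-(2 * v)⁻¹ * ‖m • y‖ ^ 2))).map
    fun y => (m / v) • y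

theorem isFiniteMeasure_weightedMeasure (P : Measure E) [IsProbabilityMeasure P] (m : ℝ) {v : ℝ}
    (hv : 0 < v) : IsFiniteMeasure (weightedMeasure P m v) := by
  have : IsFiniteMeasure
      (P.withDensity fun y => ENNReal.ofReal (Real.exp (-(2 * v)⁻¹ * ‖m • y‖ ^ 2))) := by
    refine isFiniteMeasure_withDensity (ne_top_of_le_ne_top (b := 1) (by simp) ?_)
    calc _ ≤ ∫⁻ _, 1 ∂P := lintegral_mono fun y => by
          rw [ENNReal.ofReal_le_one, Real.exp_le_one_iff, neg_mul]
          exact neg_nonpos.2 (by positivity)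
      _ = 1 := by simp
  unfold weightedMeasure
  infer_instance

variable [BorelSpace E]

theorem ae_weightedMeasure {P : Measure E} (m v : ℝ) {p : E → Prop} (hp : MeasurableSet {y | p y})
    (h : ∀ᵐ y ∂P, p ((m / v) • y)) : ∀ᵐ y ∂(weightedMeasure P m v), p y :=
  (ae_map_iff (by fun_prop) hp).2 ((withDensity_absolutelyContinuous _ _).ae_le h)

theorem ae_norm_le_weightedMeasure {P : Measure E} {m v r : ℝ} (hm : 0 ≤ m) (hv : 0 < v)
    (hP : ∀ᵐ y ∂P, ‖y‖ ≤ r) : ∀ᵐ y ∂(weightedMeasure P m v), ‖y‖ ≤ m / v * r := by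
  refine ae_weightedMeasure m v (measurableSet_le (by fun_prop) (by fun_prop)) ?_
  filter_upwards [hP] with y hy
  have : 0 ≤ m / v := by positivity
  rw [norm_smul, Real.norm_eq_abs, abs_of_nonneg this]
  gcongr

theorem neZero_weightedMeasure (P : Measure E) [IsProbabilityMeasure P] (m v : ℝ) :
    NeZero (weightedMeasure P m v) := by
  refine ⟨fun h => ?_⟩
  rw [weightedMeasure, Measure.map_eq_zero_iff (by fun_prop),
    withDensity_eq_zero_iff (by fun_prop)] at h
  obtain ⟨y, hy⟩ := h.exists
  simp only [Pi.zero_apply, ENNReal.ofReal_eq_zero] at hy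
  exact absurd hy (not_le.2 (Real.exp_pos _))

/-- In `‖x - m • y‖ ^ 2` the term in `x` alone gives the Gaussian factor, the term in `y` alone the
weight of the measure, and the cross term the exponent `⟪x, (m / v) • y⟫`. -/
theorem smoothedDensity_eq (P : Measure E) (m : ℝ) {v : ℝ} (hv : 0 < v) (x : E) :
    smoothedDensity P m v x
      = gaussianDensity v x * laplaceMoment (weightedMeasure P m v) (fun _ => (1 : ℝ)) x := by
  unfold smoothedDensity laplaceMoment weightedMeasure
  rw [integral_map (by fun_prop) (Continuous.aestronglyMeasurable (by fun_prop)),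
    integral_withDensity_eq_integral_toReal_smul (by fun_prop)
      (Filter.Eventually.of_forall fun _ => ENNReal.ofReal_lt_top), ← integral_const_mul]
  refine integral_congr_ae (Filter.Eventually.of_forall fun y => ?_)
  simp only [gaussianDensity, ENNReal.toReal_ofReal (Real.exp_pos _).le, smul_eq_mul, mul_one,
    mul_assoc, ← Real.exp_add]
  congr 2
  rw [norm_sub_sq_real]
  simp only [inner_smul_right]
  field_simp
  ring

variable [FiniteDimensional ℝ E]

theorem charFun_gaussianDensity {v : ℝ} (hv : 0 < v) (ξ : E) :
    charFun (volume.withDensity fun z : E => ENNReal.ofReal (gaussianDensity v z)) ξ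
      = Complex.exp (-(v * ‖ξ‖ ^ 2 / 2 : ℝ)) := by
  have hb : 0 < (((2 * v)⁻¹ : ℝ) : ℂ).re := by
    rw [Complex.ofReal_re]
    positivity
  have key := GaussianFourier.integral_cexp_neg_mul_sq_norm_add (V := E) hb Complex.I ξ
  rw [charFun_apply, integral_withDensity_eq_integral_toReal_smul (by fun_prop)
    (Filter.Eventually.of_forall fun _ => ENNReal.ofReal_lt_top)]
  have h : ∀ z : E, (ENNReal.ofReal (gaussianDensity v z)).toReal
      • Complex.exp (inner ℝ z ξ * Complex.I)
      = (((2 * Real.pi * v) ^ (Module.finrank ℝ E / 2 : ℝ) : ℝ) : ℂ)⁻¹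
        * Complex.exp (-(((2 * v)⁻¹ : ℝ) : ℂ) * ‖z‖ ^ 2 + Complex.I * inner ℝ ξ z) := by
    intro z
    rw [ENNReal.toReal_ofReal (gaussianDensity_pos hv z).le, gaussianDensity, Complex.exp_add,
      Complex.real_smul, real_inner_comm z ξ]
    push_cast
    ring_nf
  simp_rw [h]
  rw [integral_const_mul, key, ← mul_assoc]
  have h1 : (Real.pi / (((2 * v)⁻¹ : ℝ) : ℂ)) ^ (Module.finrank ℝ E / 2 : ℂ)
      = (((2 * Real.pi * v) ^ (Module.finrank ℝ E / 2 : ℝ) : ℝ) : ℂ) := by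
    rw [Complex.ofReal_cpow (by positivity)]
    push_cast
    congr 1
    rw [div_inv_eq_mul]
    ring
  rw [h1, inv_mul_cancel₀, one_mul]
  · congr 1
    have : (v : ℂ) ≠ 0 := by exact_mod_cast hv.ne'
    push_cast
    rw [Complex.I_sq]
    field_simp
    ring
  · have : (0 : ℝ) < (2 * Real.pi * v) ^ (Module.finrank ℝ E / 2 : ℝ) := by positivity
    exact_mod_cast this.ne'

theorem isProbabilityMeasure_gaussianDensity {v : ℝ} (hv : 0 < v) :
    IsProbabilityMeasure
      (volume.withDensity fun z : E => ENNReal.ofReal (gaussianDensity v z)) := by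
  refine ⟨?_⟩
  have h : ∀ z : E, gaussianDensity v z
      = ((2 * Real.pi * v) ^ (Module.finrank ℝ E / 2 : ℝ))⁻¹
        * Real.exp (-(2 * v)⁻¹ * ‖z‖ ^ 2) := fun z => rfl
  have hb : (0 : ℝ) < (2 * v)⁻¹ := by positivity
  have hI := GaussianFourier.integral_rexp_neg_mul_sq_norm (V := E) hb
  have hpos : (0 : ℝ) < (Real.pi / (2 * v)⁻¹) ^ (Module.finrank ℝ E / 2 : ℝ) := by positivity
  -- A non-integrable function has integral `0` by convention, so the positive value of the integral
  -- already forces integrability.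
  have hint : Integrable fun z : E => Real.exp (-(2 * v)⁻¹ * ‖z‖ ^ 2) := by
    by_contra hn
    rw [integral_undef hn] at hI
    exact hpos.ne hI
  rw [withDensity_apply _ MeasurableSet.univ, Measure.restrict_univ,
    ← ofReal_integral_eq_lintegral_ofReal (f := gaussianDensity v) (hint.const_mul _)
      (Filter.Eventually.of_forall fun z => (gaussianDensity_pos hv z).le)]
  simp_rw [h]
  rw [integral_const_mul, hI]
  have : Real.pi / (2 * v)⁻¹ = 2 * Real.pi * v := by rw [div_inv_eq_mul]; ring
  rw [this] at hpos ⊢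
  rw [inv_mul_cancel₀ hpos.ne', ENNReal.ofReal_one]

theorem map_smul_conv_gaussian (P : Measure E) [IsProbabilityMeasure P] (m : ℝ) {v : ℝ}
    (hv : 0 < v) :
    (P.map (fun y => m • y)) ∗
        (volume.withDensity fun z : E => ENNReal.ofReal (gaussianDensity v z))
      = volume.withDensity fun x => ENNReal.ofReal (smoothedDensity P m v x) := by
  have := isProbabilityMeasure_gaussianDensity (E := E) hv
  ext s hs
  have h1 : ∀ x, ENNReal.ofReal (smoothedDensity P m v x)
      = ∫⁻ y, ENNReal.ofReal (gaussianDensity v (x - m • y)) ∂P := fun x => by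
    refine ofReal_integral_eq_lintegral_ofReal ?_
      (Filter.Eventually.of_forall fun z => (gaussianDensity_pos hv _).le)
    refine Integrable.of_bound (Continuous.aestronglyMeasurable (by fun_prop))
      (((2 * Real.pi * v) ^ (Module.finrank ℝ E / 2 : ℝ))⁻¹)
      (Filter.Eventually.of_forall fun z => ?_)
    rw [Real.norm_eq_abs, abs_of_pos (gaussianDensity_pos hv _)]
    exact gaussianDensity_le hv _
  have hm : Measurable (s.indicator (1 : E → ℝ≥0∞)) := measurable_one.indicator hs
  rw [withDensity_apply _ hs, ← lintegral_indicator_one hs, Measure.lintegral_conv hm,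
    lintegral_map (by fun_prop) (by fun_prop)]
  simp_rw [h1]
  have hg : Measurable fun z : E => ENNReal.ofReal (gaussianDensity v z) := by fun_prop
  rw [lintegral_lintegral_swap (μ := volume.restrict s) (ν := P)
    (f := fun x y => ENNReal.ofReal (gaussianDensity v (x - m • y))) (by fun_prop)]
  refine lintegral_congr fun y => ?_
  rw [lintegral_withDensity_eq_lintegral_mul _ hg (by fun_prop), ← lintegral_indicator hs]
  -- After Tonelli, for fixed `y`, translation invariance of Lebesgue measure recentres the kernel.
  conv_rhs => rw [← lintegral_add_left_eq_self _ (m • y)]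
  refine lintegral_congr fun z => ?_
  by_cases hz : m • y + z ∈ s <;> simp [hz, Set.indicator]

section Score

variable {P : Measure E} [IsProbabilityMeasure P] {m v r : ℝ}

theorem smoothedDensity_pos (hm : 0 ≤ m) (hv : 0 < v) (hP : ∀ᵐ y ∂P, ‖y‖ ≤ r) (x : E) :
    0 < smoothedDensity P m v x := by
  have := isFiniteMeasure_weightedMeasure P m hv
  have := neZero_weightedMeasure P m v
  rw [smoothedDensity_eq P m hv]
  exact mul_pos (gaussianDensity_pos hv x)
    (laplaceMoment_one_pos (ae_norm_le_weightedMeasure hm hv hP) x)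

theorem contDiff_smoothedDensity (hm : 0 ≤ m) (hv : 0 < v) (hP : ∀ᵐ y ∂P, ‖y‖ ≤ r) :
    ContDiff ℝ (⊤ : ℕ∞) (smoothedDensity P m v) := by
  have := isFiniteMeasure_weightedMeasure P m hv
  rw [funext (smoothedDensity_eq P m hv)]
  refine ContDiff.mul ?_
    (contDiff_laplaceMoment (ae_norm_le_weightedMeasure hm hv hP) continuous_const)
  unfold gaussianDensity
  exact contDiff_const.mul (contDiff_const.mul (contDiff_norm_sq ℝ)).exp

/-- The score is the reference Gaussian score plus a tilted mean. -/
theorem gradient_log_smoothedDensity (hm : 0 ≤ m) (hv : 0 < v) (hP : ∀ᵐ y ∂P, ‖y‖ ≤ r) (x : E) :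
    gradient (fun y => Real.log (smoothedDensity P m v y)) x
      = tiltedMean (weightedMeasure P m v) x - v⁻¹ • x := by
  have := isFiniteMeasure_weightedMeasure P m hv
  have := neZero_weightedMeasure P m v
  have hQ := ae_norm_le_weightedMeasure (m := m) hm hv hP
  refine HasGradientAt.gradient ?_
  have h : ∀ y, Real.log (smoothedDensity P m v y)
      = Real.log ((2 * Real.pi * v) ^ (Module.finrank ℝ E / 2 : ℝ))⁻¹
        + -(2 * v)⁻¹ * ‖y‖ ^ 2
        + Real.log (laplaceMoment (weightedMeasure P m v) (fun _ => (1 : ℝ)) y) := fun y => by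
    rw [smoothedDensity_eq P m hv, Real.log_mul (gaussianDensity_pos hv y).ne'
      (laplaceMoment_one_pos hQ y).ne', gaussianDensity, Real.log_mul (by positivity)
      (Real.exp_ne_zero _), Real.log_exp]
  rw [funext h, hasGradientAt_iff_hasFDerivAt]
  have h1 := (hasGradientAt_iff_hasFDerivAt.1 (hasGradientAt_log_laplaceMoment hQ x))
  have h2 := ((hasStrictFDerivAt_norm_sq x).hasFDerivAt.const_mul (-(2 * v)⁻¹)).const_add
    (Real.log ((2 * Real.pi * v) ^ (Module.finrank ℝ E / 2 : ℝ))⁻¹)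
  convert! h2.add h1 using 1
  rw [map_sub, map_smul, sub_eq_neg_add]
  congr 1
  ext u
  simp
  field_simp

theorem norm_gradient_log_smoothedDensity_add_le (hm : 0 ≤ m) (hv : 0 < v)
    (hP : ∀ᵐ y ∂P, ‖y‖ ≤ r) (x : E) :
    ‖gradient (fun y => Real.log (smoothedDensity P m v y)) x + v⁻¹ • x‖ ≤ m / v * r := by
  have := isFiniteMeasure_weightedMeasure P m hv
  have := neZero_weightedMeasure P m v
  rw [gradient_log_smoothedDensity hm hv hP, sub_add_cancel]
  exact norm_tiltedMean_le (ae_norm_le_weightedMeasure hm hv hP) x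

theorem norm_fderiv_gradient_log_smoothedDensity_add_le (hm : 0 ≤ m) (hv : 0 < v)
    (hP : ∀ᵐ y ∂P, ‖y‖ ≤ r) {c : E} {s : ℝ} (hs : ∀ᵐ y ∂P, ‖y - c‖ ≤ s) (x : E) :
    ‖fderiv ℝ (gradient fun y => Real.log (smoothedDensity P m v y)) x
      + v⁻¹ • ContinuousLinearMap.id ℝ E‖ ≤ 2 * (m / v * s) ^ 2 := by
  have := isFiniteMeasure_weightedMeasure P m hv
  have := neZero_weightedMeasure P m v
  have hQ := ae_norm_le_weightedMeasure (m := m) hm hv hP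
  have hQ' : ∀ᵐ y ∂(weightedMeasure P m v), ‖y - (m / v) • c‖ ≤ m / v * s := by
    refine ae_weightedMeasure m v (measurableSet_le (by fun_prop) (by fun_prop)) ?_
    filter_upwards [hs] with y hy
    have : 0 ≤ m / v := by positivity
    rw [← smul_sub, norm_smul, Real.norm_eq_abs, abs_of_nonneg this]
    gcongr
  obtain ⟨V, hV, hb⟩ := norm_fderiv_tiltedMean_le hQ hQ' x
  have h : HasFDerivAt (fun z => tiltedMean (weightedMeasure P m v) z - v⁻¹ • z)
      (V - v⁻¹ • ContinuousLinearMap.id ℝ E) x := hV.sub ((hasFDerivAt_id x).const_smul v⁻¹)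
  rw [funext (gradient_log_smoothedDensity (m := m) hm hv hP), h.fderiv, sub_add_cancel]
  exact hb

end Score

end GaussianSmoothing

/-! ### The law of the forward process. -/

section OrnsteinUhlenbeck

open Filter Topology

/-- The `k`-th point of the regular subdivision of `[0, t]` into `n` intervals. -/
def gridPoint (t : ℝ≥0) (n k : ℕ) : ℝ≥0 := k * (t / n)

theorem gridPoint_mono (t : ℝ≥0) (n : ℕ) : Monotone (gridPoint t n) := fun i j h => by
  unfold gridPoint
  gcongr

theorem coe_gridPoint (t : ℝ≥0) (n k : ℕ) : (gridPoint t n k : ℝ) = k * (t / n) := by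
  simp [gridPoint]

theorem gridPoint_self (t : ℝ≥0) {n : ℕ} (hn : n ≠ 0) : gridPoint t n n = t := by
  unfold gridPoint
  field_simp

theorem coe_gridPoint_succ (t : ℝ≥0) (n k : ℕ) :
    (gridPoint t n (k + 1) : ℝ) = gridPoint t n k + t / n := by
  simp only [coe_gridPoint]
  push_cast
  ring

/-- The Riemann sum of the Wiener integral `∫₀ᵗ exp (-(t - s) / 2) dB_s`. -/
def ouSum {E : Type*} [AddCommGroup E] [Module ℝ E] (t : ℝ≥0) (n : ℕ) (b : ℝ≥0 → E) : E :=
  ∑ k ∈ Finset.range n, Real.exp (-(t - gridPoint t n k) / 2) •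
    (b (gridPoint t n (k + 1)) - b (gridPoint t n k))

/-- The variance of `ouSum` along a Brownian path. -/
def ouVar (t : ℝ≥0) (n : ℕ) : ℝ :=
  ∑ k ∈ Finset.range n, Real.exp (-(t - gridPoint t n k)) * (t / n)

/-- A deterministic statement about one continuous path: the integrating factor `w u = exp (-(t - u)
/ 2)` formally gives `d(w x) = w db`, because `w' = w / 2` cancels the drift. The sums therefore
approximate the increment of `w x` over `[0, t]`. -/
theorem tendsto_ouSum {E : Type*} [NormedAddCommGroup E] [NormedSpace ℝ E] [CompleteSpace E]
    {x b : ℝ≥0 → E} (hx : Continuous x)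
    (hb : ∀ s, x s = x 0 - (1 / 2 : ℝ) • (∫ u in (0 : ℝ)..(s : ℝ), x u.toNNReal) + b s) (t : ℝ≥0) :
    Tendsto (fun n => ouSum t n b) atTop (𝓝 (x t - Real.exp (-t / 2) • x 0)) := by
  set w : ℝ → ℝ := fun u => Real.exp (-(t - u) / 2) with hw
  set y : ℝ → E := fun u => x u.toNNReal with hy
  have hwc : Continuous w := by fun_prop
  have hyc : Continuous y := hx.comp continuous_real_toNNReal
  have hyx : ∀ s : ℝ≥0, y s = x s := fun s => by simp [hy]
  have hincr : ∀ r s : ℝ≥0, b s - b r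
      = y s - y r + (1 / 2 : ℝ) • ∫ u in (r : ℝ)..s, y u := fun r s => by
    rw [hyx, hyx, hb s, hb r, ← intervalIntegral.integral_interval_sub_left
      (hyc.intervalIntegrable 0 s) (hyc.intervalIntegrable 0 r)]
    module
  have hwint : ∀ r s : ℝ, w s - w r = (1 / 2 : ℝ) * ∫ u in r..s, w u := fun r s => by
    rw [← intervalIntegral.integral_const_mul]
    refine (intervalIntegral.integral_eq_sub_of_hasDerivAt (fun u _ => ?_)
      ((hwc.const_mul _).intervalIntegrable _ _)).symm
    have h1 : HasDerivAt (fun u : ℝ => -(t - u) / 2) (1 / 2 : ℝ) u := by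
      simpa using (((hasDerivAt_id u).const_sub (t : ℝ)).neg).div_const 2
    simpa [hw, mul_comm] using h1.exp
  -- The exact error of one Riemann step. The integrand vanishes when `u`, `r` and `s` coincide, so
  -- uniform continuity makes it small on a fine grid.
  have herr : ∀ r s : ℝ≥0, (w s • y s - w r • y r) - w r • (b s - b r)
      = (1 / 2 : ℝ) • ∫ u in (r : ℝ)..s, (w u • y s - w r • y u) := fun r s => by
    rw [intervalIntegral.integral_sub, intervalIntegral.integral_smul_const,
      intervalIntegral.integral_smul, hincr, smul_sub, ← smul_assoc, smul_eq_mul, ← hwint]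
    · module
    · exact Continuous.intervalIntegrable (by fun_prop) _ _
    · exact Continuous.intervalIntegrable (by fun_prop) _ _
  have huc : UniformContinuousOn (fun p : ℝ × ℝ => w p.1 • y p.2)
      (Set.Icc 0 (t : ℝ) ×ˢ Set.Icc 0 (t : ℝ)) :=
    (isCompact_Icc.prod isCompact_Icc).uniformContinuousOn_of_continuous
      (Continuous.continuousOn (by fun_prop))
  rw [Metric.tendsto_atTop]
  intro ε hε
  -- The step errors add up to at most `ε * t / (2 * (t + 1)) < ε`; the `+ 1` covers `t = 0`.
  obtain ⟨δ, hδ, hF⟩ := Metric.uniformContinuousOn_iff.1 huc (ε / (t + 1)) (by positivity)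
  obtain ⟨N, hN⟩ := exists_nat_gt ((t : ℝ) / δ)
  refine ⟨N + 1, fun n hn => ?_⟩
  have hn0 : n ≠ 0 := by lia
  have hnpos : (0 : ℝ) < n := by positivity
  have hstep : (t : ℝ) / n < δ := by
    rw [div_lt_iff₀ hnpos]
    rw [div_lt_iff₀ hδ] at hN
    have : (N : ℝ) ≤ n := by exact_mod_cast (by lia : N ≤ n)
    nlinarith
  have hgrid : ∀ k ≤ n, (gridPoint t n k : ℝ) ∈ Set.Icc 0 (t : ℝ) := fun k hk =>
    ⟨NNReal.coe_nonneg _, NNReal.coe_le_coe.2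
      ((gridPoint_mono t n hk).trans_eq (gridPoint_self t hn0))⟩
  have htel : (x t - Real.exp (-t / 2) • x 0) - ouSum t n b = ∑ k ∈ Finset.range n,
      ((w (gridPoint t n (k + 1)) • y (gridPoint t n (k + 1))
        - w (gridPoint t n k) • y (gridPoint t n k))
        - w (gridPoint t n k) • (b (gridPoint t n (k + 1)) - b (gridPoint t n k))) := by
    rw [Finset.sum_sub_distrib,
      Finset.sum_range_sub (fun k => w (gridPoint t n k) • y (gridPoint t n k)),
      gridPoint_self t hn0]
    simp [ouSum, hw, hy, gridPoint]
  have hterm : ∀ k ∈ Finset.range n, ‖(w (gridPoint t n (k + 1)) • y (gridPoint t n (k + 1))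
        - w (gridPoint t n k) • y (gridPoint t n k))
        - w (gridPoint t n k) • (b (gridPoint t n (k + 1)) - b (gridPoint t n k))‖
      ≤ (1 / 2) * (ε / (t + 1) * (t / n)) := fun k hk => by
    have hk' := Finset.mem_range.1 hk
    have hle : (gridPoint t n k : ℝ) ≤ gridPoint t n (k + 1) :=
      NNReal.coe_le_coe.2 (gridPoint_mono t n (by lia))
    have hsub := coe_gridPoint_succ t n k
    rw [herr, norm_smul, Real.norm_eq_abs, abs_of_pos (by norm_num)]
    gcongr
    have hint := intervalIntegral.norm_integral_le_of_norm_le_const (a := (gridPoint t n k : ℝ))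
      (b := gridPoint t n (k + 1)) (C := ε / (t + 1))
      (f := fun u => w u • y (gridPoint t n (k + 1)) - w (gridPoint t n k) • y u) ?_
    · refine hint.trans_eq ?_
      rw [hsub, add_sub_cancel_left, abs_of_nonneg (by positivity)]
    · intro u hu
      rw [Set.uIoc_of_le hle] at hu
      have hu' : u ∈ Set.Icc 0 (t : ℝ) :=
        ⟨(hgrid k hk'.le).1.trans hu.1.le, hu.2.trans (hgrid (k + 1) hk').2⟩
      have := hF (u, gridPoint t n (k + 1)) ⟨hu', hgrid _ hk'⟩ (gridPoint t n k, u)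
        ⟨hgrid _ hk'.le, hu'⟩ ?_
      · rw [dist_eq_norm] at this
        exact this.le
      · rw [Prod.dist_eq, max_lt_iff, Real.dist_eq, Real.dist_eq]
        have h1 := hu.1
        have h2 := hu.2
        constructor <;> rw [abs_of_nonneg (by linarith)] <;> linarith
  rw [dist_comm, dist_eq_norm, htel]
  refine (norm_sum_le_of_le _ hterm).trans_lt ?_
  rw [Finset.sum_const, Finset.card_range, nsmul_eq_mul]
  have : (n : ℝ) * (1 / 2 * (ε / (t + 1) * (t / n))) = ε * (t / (2 * (t + 1))) := by
    field_simp
  rw [this]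
  refine mul_lt_of_lt_one_right hε ?_
  rw [div_lt_one (by positivity)]
  have := t.coe_nonneg
  linarith

/-- The sum is geometric: with step `h = t / n` it equals `(1 - exp (-t)) / ((exp h - 1) / h)`, and
the denominator is a difference quotient of `exp` at `0`. -/
theorem tendsto_ouVar {t : ℝ≥0} (ht : 0 < t) :
    Tendsto (ouVar t) atTop (𝓝 (1 - Real.exp (-t))) := by
  have hpos : (0 : ℝ) < t := by exact_mod_cast ht
  have hstep : Tendsto (fun n : ℕ => (t : ℝ) / n) atTop (𝓝[≠] 0) := by
    refine tendsto_nhdsWithin_iff.2 ⟨tendsto_const_div_atTop_nhds_zero_nat _, ?_⟩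
    filter_upwards [eventually_gt_atTop 0] with n hn
    have : (0 : ℝ) < n := by exact_mod_cast hn
    exact (div_pos hpos this).ne'
  have hslope := (hasDerivAt_iff_tendsto_slope_zero.1 (Real.hasDerivAt_exp 0)).comp hstep
  rw [Real.exp_zero] at hslope
  have h := (tendsto_const_nhds (x := 1 - Real.exp (-t))).div hslope one_ne_zero
  rw [div_one] at h
  refine h.congr' ?_
  filter_upwards [eventually_gt_atTop 0] with n hn
  have hn' : (0 : ℝ) < n := by exact_mod_cast hn
  have hne : Real.exp (t / n) - 1 ≠ 0 := by
    have : 0 < (t : ℝ) / n := by positivity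
    have := Real.add_one_lt_exp this.ne'
    linarith
  have htel : 1 - Real.exp (-t) = (∑ k ∈ Finset.range n, Real.exp (-(t - gridPoint t n k)))
      * (Real.exp (t / n) - 1) := by
    have h1 := Finset.sum_range_sub (fun k => Real.exp (-(t - gridPoint t n k))) n
    rw [gridPoint_self t hn.ne'] at h1
    simp only [sub_self, neg_zero, Real.exp_zero] at h1
    rw [Finset.sum_mul]
    have h0 : (gridPoint t n 0 : ℝ) = 0 := by simp [gridPoint]
    rw [h0, sub_zero] at h1
    rw [← h1]
    refine Finset.sum_congr rfl fun k _ => ?_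
    rw [mul_sub, mul_one, ← Real.exp_add, coe_gridPoint_succ]
    ring_nf
  simp only [Pi.div_apply, Function.comp_apply, ouVar, zero_add, smul_eq_mul]
  rw [← Finset.sum_mul, htel]
  field_simp

variable {Ω : Type*} [MeasurableSpace Ω] {μ : Measure Ω}

theorem aemeasurable_ouSum {b : ℝ≥0 → Ω → ℝ} (hb : ∀ s, AEMeasurable (b s) μ) (t : ℝ≥0) (n : ℕ) :
    AEMeasurable (fun ω => ouSum t n fun s => b s ω) μ := by
  unfold ouSum
  refine Finset.aemeasurable_fun_sum _ fun k _ => ?_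
  exact ((hb (gridPoint t n (k + 1))).sub (hb (gridPoint t n k))).const_mul
    (Real.exp (-(t - gridPoint t n k) / 2))

/-- The sum is a linear combination of independent centred Gaussian increments, each of variance `t
/ n`, so the characteristic functions multiply and the variances add. -/
theorem charFun_map_ouSum_real [IsProbabilityMeasure μ] {b : ℝ≥0 → Ω → ℝ}
    (hb : IsPreBrownianReal b μ) (t : ℝ≥0) (n : ℕ) (ξ : ℝ) :
    charFun (μ.map fun ω => ouSum t n fun s => b s ω) ξ
      = Complex.exp (-(ouVar t n * ξ ^ 2 / 2 : ℝ)) := by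
  have hind := (hb.hasIndepIncrements.nat (gridPoint_mono t n)).comp
    (fun k (z : ℝ) => Real.exp (-(t - gridPoint t n k) / 2) • z) (fun k => by fun_prop)
  have hm : ∀ k, AEMeasurable (fun ω => b (gridPoint t n (k + 1)) ω - b (gridPoint t n k) ω) μ :=
    fun k => (hb.aemeasurable _).sub (hb.aemeasurable _)
  have h := iIndepFun.charFun_map_fun_finsetSum_eq_prod (s := Finset.range n)
    (fun k _ => (hm k).const_mul (Real.exp (-(t - gridPoint t n k) / 2))) (hind.restrict _)
  unfold ouSum
  refine (congrFun h ξ).trans ?_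
  rw [Finset.prod_apply]
  have hk : ∀ k, charFun (μ.map fun ω => Real.exp (-(t - gridPoint t n k) / 2) •
      (b (gridPoint t n (k + 1)) ω - b (gridPoint t n k) ω)) ξ
      = Complex.exp (-(Real.exp (-(t - gridPoint t n k)) * (t / n) * ξ ^ 2 / 2 : ℝ)) := by
    intro k
    rw [charFun_map_smul_comp (hm k)]
    have hlaw := (hb.hasLaw_sub (gridPoint t n (k + 1)) (gridPoint t n k)).map_eq
    have hd : ((nndist (gridPoint t n (k + 1)).1 (gridPoint t n k).1 : ℝ≥0) : ℝ) = t / n := by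
      rw [coe_nndist, Real.dist_eq]
      have := coe_gridPoint_succ t n k
      change |(gridPoint t n (k + 1) : ℝ) - gridPoint t n k| = t / n
      rw [this, add_sub_cancel_left, abs_of_nonneg (by positivity)]
    have he : Real.exp (-(t - gridPoint t n k) / 2) ^ 2 = Real.exp (-(t - gridPoint t n k)) := by
      rw [← Real.exp_nat_mul]
      congr 1
      push_cast
      ring
    change charFun (μ.map (b (gridPoint t n (k + 1)) - b (gridPoint t n k))) _ = _
    rw [hlaw, charFun_gaussianReal, ← he, ← hd]
    congr 1
    push_cast
    simp only [smul_eq_mul]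
    push_cast
    ring
  refine (Finset.prod_congr rfl fun k _ => hk k).trans ?_
  rw [← Complex.exp_sum]
  congr 1
  unfold ouVar
  push_cast
  rw [Finset.sum_neg_distrib, Finset.sum_mul, Finset.sum_div]

theorem ouSum_apply {d : ℕ} (t : ℝ≥0) (n : ℕ) (b : ℝ≥0 → Rd d) (i : Fin d) :
    ouSum t n b i = ouSum t n fun s => b s i := by
  simp [ouSum]

theorem IsBrownianMotion.aemeasurable_ouSum {d : ℕ} {B : ℝ≥0 → Ω → Rd d}
    (hB : IsBrownianMotion B μ) (t : ℝ≥0) (n : ℕ) :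
    AEMeasurable (fun ω => ouSum t n fun s => B s ω) μ := by
  have h : AEMeasurable (fun ω (i : Fin d) => ouSum t n fun s => B s ω i) μ :=
    aemeasurable_pi_lambda _ fun i => _root_.aemeasurable_ouSum (hB.coord i).aemeasurable t n
  have h2 := (WithLp.measurable_toLp 2 (Fin d → ℝ)).comp_aemeasurable h
  convert! h2 using 2 with ω
  ext i
  simp [ouSum_apply]

theorem IsBrownianMotion.charFun_map_ouSum [IsProbabilityMeasure μ] {d : ℕ} {B : ℝ≥0 → Ω → Rd d}
    (hB : IsBrownianMotion B μ) (t : ℝ≥0) (n : ℕ) (ξ : Rd d) :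
    charFun (μ.map fun ω => ouSum t n fun s => B s ω) ξ
      = Complex.exp (-(ouVar t n * ‖ξ‖ ^ 2 / 2 : ℝ)) := by
  have hmeas : Measurable fun b : ℝ≥0 → ℝ => ouSum t n b := by
    unfold ouSum
    fun_prop
  have hind := hB.indep.comp (fun _ b => ouSum t n b) fun _ => hmeas
  have h := (iIndepFun_iff_charFun_pi fun i =>
    _root_.aemeasurable_ouSum (hB.coord i).aemeasurable t n).1 hind ξ
  have he : (fun ω => ouSum t n fun s => B s ω)
      = fun ω => WithLp.toLp 2 fun i => ouSum t n fun s => B s ω i := by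
    funext ω
    ext i
    simp [ouSum_apply]
  rw [he]
  refine h.trans ?_
  refine (Finset.prod_congr rfl fun i _ =>
    charFun_map_ouSum_real (hB.coord i).toIsPreBrownianReal t n (ξ i)).trans ?_
  rw [← Complex.exp_sum, EuclideanSpace.real_norm_sq_eq]
  congr 1
  push_cast
  rw [Finset.sum_neg_distrib, Finset.mul_sum, Finset.sum_div]

/-- The characteristic function of the law at time `t` of the forward process with `C = 1`. -/
theorem IsForwardProcess.charFun_map [IsProbabilityMeasure μ] {d : ℕ} {P₀ : Measure (Rd d)}
    {B X : ℝ≥0 → Ω → Rd d} (hX : IsForwardProcess (1 : Matrix (Fin d) (Fin d) ℝ) P₀ B X μ)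
    {t : ℝ≥0} (ht : 0 < t) (ξ : Rd d) :
    charFun (μ.map (X t)) ξ = charFun (P₀.map fun y => Real.exp (-t / 2) • y) ξ
      * Complex.exp (-((1 - Real.exp (-t)) * ‖ξ‖ ^ 2 / 2 : ℝ)) := by
  have hS := hX.brownian.aemeasurable_ouSum t
  have hX0 : AEMeasurable (fun ω => Real.exp (-t / 2) • X 0 ω) μ :=
    (hX.aemeasurable 0).const_smul (Real.exp (-t / 2))
  have hmeas : ∀ n, Measurable fun b : ℝ≥0 → Rd d => ouSum t n b := fun n => by
    unfold ouSum
    fun_prop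
  have hlaw : μ.map (fun ω => Real.exp (-t / 2) • X 0 ω)
      = P₀.map fun y => Real.exp (-t / 2) • y := by
    rw [← hX.initial.map_eq, AEMeasurable.map_map_of_aemeasurable (by fun_prop) (hX.aemeasurable 0)]
    rfl
  -- Independence of `X 0` and `B` factors the characteristic function of the approximation before
  -- any limit is taken.
  have hprod : ∀ n, ∫ ω, Complex.exp (inner ℝ (Real.exp (-t / 2) • X 0 ω
        + ouSum t n fun s => B s ω) ξ * Complex.I) ∂μ
      = charFun (P₀.map fun y => Real.exp (-t / 2) • y) ξ
        * Complex.exp (-(ouVar t n * ‖ξ‖ ^ 2 / 2 : ℝ)) := fun n => by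
    have hind := hX.indep.comp (φ := fun y => Real.exp (-t / 2) • y)
      (ψ := fun b : ℝ≥0 → Rd d => ouSum t n b) (by fun_prop) (hmeas n)
    have h := congrFun (hind.charFun_map_fun_add_eq_mul hX0 (hS n)) ξ
    have h2 := hX.brownian.charFun_map_ouSum t n ξ
    rw [Pi.mul_apply, charFun_apply, integral_map (hX0.fun_add (hS n))
      (Continuous.aestronglyMeasurable (by fun_prop))] at h
    rw [← hlaw, ← h2]
    exact h
  -- The pathwise limit `exp (-t / 2) • X 0 + (X t - exp (-t / 2) • X 0)` is `X t`; the integrands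
  -- have modulus `1`, so convergence is dominated.
  have hlim1 : Tendsto (fun n => ∫ ω, Complex.exp (inner ℝ (Real.exp (-t / 2) • X 0 ω
        + ouSum t n fun s => B s ω) ξ * Complex.I) ∂μ) atTop (𝓝 (charFun (μ.map (X t)) ξ)) := by
    rw [charFun_apply, integral_map (hX.aemeasurable t)
      (Continuous.aestronglyMeasurable (by fun_prop))]
    refine tendsto_integral_of_dominated_convergence (fun _ => 1) (fun n => ?_)
      (integrable_const _) (fun n => Eventually.of_forall fun ω => ?_) ?_
    · exact (Continuous.measurable (f := fun y : Rd d =>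
        Complex.exp (inner ℝ y ξ * Complex.I)) (by fun_prop)).comp_aemeasurable
          (hX0.add (hS n)) |>.aestronglyMeasurable
    · rw [Complex.norm_exp_ofReal_mul_I]
    · filter_upwards [hX.continuous_paths, hX.equation] with ω hc he
      have h := tendsto_ouSum (x := fun s => X s ω) (b := fun s => B s ω) hc
        (fun s => by simpa using he s) t
      have h2 := h.const_add (Real.exp (-t / 2) • X 0 ω)
      rw [add_sub_cancel] at h2
      exact (Continuous.tendsto (f := fun y : Rd d =>
        Complex.exp (inner ℝ y ξ * Complex.I)) (by fun_prop) _).comp h2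
  have hlim2 : Tendsto (fun n => charFun (P₀.map fun y => Real.exp (-t / 2) • y) ξ
        * Complex.exp (-(ouVar t n * ‖ξ‖ ^ 2 / 2 : ℝ))) atTop
      (𝓝 (charFun (P₀.map fun y => Real.exp (-t / 2) • y) ξ
      * Complex.exp (-((1 - Real.exp (-t)) * ‖ξ‖ ^ 2 / 2 : ℝ)))) := by
    refine Tendsto.const_mul _ ?_
    exact (Continuous.tendsto (f := fun v : ℝ => Complex.exp (-(v * ‖ξ‖ ^ 2 / 2 : ℝ)))
      (by fun_prop) _).comp (tendsto_ouVar ht)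
  exact tendsto_nhds_unique hlim1 ((funext hprod) ▸ hlim2)

/-- The law at time `t` of the forward process with `C = 1` is a Gaussian smoothing of `P₀`. -/
theorem IsForwardProcess.map_eq_withDensity [IsProbabilityMeasure μ] {d : ℕ} {P₀ : Measure (Rd d)}
    [IsProbabilityMeasure P₀] {B X : ℝ≥0 → Ω → Rd d}
    (hX : IsForwardProcess (1 : Matrix (Fin d) (Fin d) ℝ) P₀ B X μ) {t : ℝ≥0} (ht : 0 < t) :
    μ.map (X t) = volume.withDensity fun x =>
      ENNReal.ofReal (smoothedDensity P₀ (Real.exp (-t / 2)) (1 - Real.exp (-t)) x) := by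
  have hv : 0 < 1 - Real.exp (-t) := by
    rw [sub_pos, Real.exp_lt_one_iff]
    exact neg_neg_of_pos (by exact_mod_cast ht)
  have := isProbabilityMeasure_gaussianDensity (E := Rd d) hv
  rw [← map_smul_conv_gaussian P₀ _ hv]
  refine Measure.ext_of_charFun (funext fun ξ => ?_)
  rw [hX.charFun_map ht, charFun_conv, charFun_gaussianDensity hv]

end OrnsteinUhlenbeck

end

/-! ### From the support hypotheses to the final estimates. -/

theorem BoundedSupport.exists_ae_norm_le {d : ℕ} {P : Measure (Rd d)} {R : ℝ}
    (h : BoundedSupport P R) : ∃ r, ∀ᵐ y ∂P, ‖y‖ ≤ r := by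
  obtain ⟨r, hr⟩ := h.1.exists_norm_le
  exact ⟨r, by filter_upwards [Measure.support_mem_ae] with y hy using hr y hy⟩

/-- Any point of the support can serve as centre. This lets the Hessian bound depend on the diameter
and not on the position of the support. -/
theorem BoundedSupport.exists_ae_norm_sub_le {d : ℕ} {P : Measure (Rd d)} [NeZero P] {R : ℝ}
    (h : BoundedSupport P R) : ∃ c, ∀ᵐ y ∂P, ‖y - c‖ ≤ R := by
  have hP : ∀ᵐ y ∂P, y ∈ P.support := Measure.support_mem_ae
  obtain ⟨c, hc⟩ := hP.exists
  refine ⟨c, ?_⟩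
  filter_upwards [hP] with y hy
  rw [← dist_eq_norm]
  exact (Metric.dist_le_diam_of_mem h.1 hy hc).trans h.2

theorem supNorm_le {d : ℕ} {F : Type*} [NormedAddCommGroup F] {f : Rd d → F} {c : ℝ}
    (h : ∀ x, ‖f x‖ ≤ c) : supNorm f ≤ ENNReal.ofReal c :=
  iSup_le fun x => by
    rw [← ofReal_norm]
    exact ENNReal.ofReal_le_ofReal (h x)

theorem toEuclideanCLM_inv_smul_one {d : ℕ} {v : ℝ} (hv : v ≠ 0) :
    Matrix.toEuclideanCLM (𝕜 := ℝ) (v • (1 : Matrix (Fin d) (Fin d) ℝ))⁻¹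
      = v⁻¹ • ContinuousLinearMap.id ℝ (Rd d) := by
  have h : (v • (1 : Matrix (Fin d) (Fin d) ℝ))⁻¹ = v⁻¹ • 1 :=
    Matrix.inv_eq_left_inv (by simp [smul_smul, hv])
  rw [h, map_smul, map_one]
  rfl

theorem corollary4 {d : ℕ} {Ω : Type*} [MeasurableSpace Ω] (μ : Measure Ω) [IsProbabilityMeasure μ]
    (P₀ : Measure (Rd d)) [IsProbabilityMeasure P₀] (B X : ℝ≥0 → Ω → Rd d)
    (hX : IsForwardProcess (1 : Matrix (Fin d) (Fin d) ℝ) P₀ B X μ)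
    (R : ℝ) (hR : BoundedSupport P₀ R) :
    ∃ p : ℝ≥0 → Rd d → ℝ,
      (∀ t : ℝ≥0, 0 < t → IsSmoothDensity (p t) (μ.map (X t))) ∧
      ∀ (δ : ℝ≥0) (A : Matrix (Fin d) (Fin d) ℝ) (Abar : ℝ≥0 → Matrix (Fin d) (Fin d) ℝ),
        0 < δ →
        A = (1 - Real.exp (-δ)) • (1 : Matrix (Fin d) (Fin d) ℝ) →
        (∀ t : ℝ≥0, Abar t = interpCov A 1 ((t : ℝ) - δ)) →
        ∀ t : ℝ≥0, δ ≤ t →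
          Abar t = (1 - Real.exp (-t)) • (1 : Matrix (Fin d) (Fin d) ℝ) ∧
          supNorm (fun x => hessian (fun y => Real.log (p t y)) x
              + Matrix.toEuclideanCLM (𝕜 := ℝ) (Abar t)⁻¹)
            ≤ ENNReal.ofReal (3 * (R / (1 - Real.exp (-δ))) ^ 2 * Real.exp (-t)) ∧
          (P₀.support ⊆ Metric.closedBall 0 R →
            supNorm (fun x => gradient (fun y => Real.log (p t y)) x
                + Matrix.toEuclideanCLM (𝕜 := ℝ) (Abar t)⁻¹ x)
              ≤ ENNReal.ofReal (R / (1 - Real.exp (-δ)) * Real.exp (-t / 2))) := by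
  obtain ⟨r, hr⟩ := hR.exists_ae_norm_le
  obtain ⟨c, hc⟩ := hR.exists_ae_norm_sub_le
  have hR0 : 0 ≤ R := Metric.diam_nonneg.trans hR.2
  have hvar : ∀ t : ℝ≥0, 0 < t → 0 < 1 - Real.exp (-t) := fun t ht => by
    rw [sub_pos, Real.exp_lt_one_iff]
    exact neg_neg_of_pos (by exact_mod_cast ht)
  have hm : ∀ t : ℝ≥0, 0 ≤ Real.exp (-t / 2) := fun t => (Real.exp_pos _).le
  refine ⟨fun t => smoothedDensity P₀ (Real.exp (-t / 2)) (1 - Real.exp (-t)),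
    fun t ht => ⟨?_, ?_, ?_⟩, fun δ A Abar hδ hA hAbar t hδt => ?_⟩
  · exact contDiff_smoothedDensity (hm t) (hvar t ht) hr
  · exact smoothedDensity_pos (hm t) (hvar t ht) hr
  · exact hX.map_eq_withDensity ht
  have ht : 0 < t := hδ.trans_le hδt
  have hv := hvar t ht
  have hvδ := hvar δ hδ
  have hle : 1 - Real.exp (-δ) ≤ 1 - Real.exp (-t) := by gcongr
  have hmean : Abar t = (1 - Real.exp (-t)) • (1 : Matrix (Fin d) (Fin d) ℝ) := by
    rw [hAbar, interpCov, hA, smul_smul, ← add_smul]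
    congr 1
    have : Real.exp (-((t : ℝ) - δ)) * Real.exp (-δ) = Real.exp (-t) := by
      rw [← Real.exp_add]
      ring_nf
    linear_combination -this
  have hfac : Real.exp (-t / 2) / (1 - Real.exp (-t)) * R
      ≤ R / (1 - Real.exp (-δ)) * Real.exp (-t / 2) := by
    rw [div_mul_eq_mul_div, div_mul_eq_mul_div, mul_comm R]
    gcongr
  refine ⟨hmean, supNorm_le fun x => ?_, fun hsub => supNorm_le fun x => ?_⟩
  · rw [hmean, toEuclideanCLM_inv_smul_one hv.ne', hessian]
    refine (norm_fderiv_gradient_log_smoothedDensity_add_le (hm t) hv hr hc x).trans ?_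
    have hsq : Real.exp (-t) = Real.exp (-t / 2) ^ 2 := by
      rw [← Real.exp_nat_mul]
      congr 1
      push_cast
      ring
    rw [hsq, mul_assoc, ← mul_pow]
    -- The covariance estimate gives the constant `2`, which is weakened here to `3`.
    refine mul_le_mul (by norm_num) ?_ (by positivity) (by norm_num)
    rw [← hsq]
    gcongr
  · rw [hmean, toEuclideanCLM_inv_smul_one hv.ne']
    have hR' : ∀ᵐ y ∂P₀, ‖y‖ ≤ R := by
      filter_upwards [Measure.support_mem_ae] with y hy
      simpa using hsub hy
    exact (norm_gradient_log_smoothedDensity_add_le (hm t) hv hR' x).trans hfac
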